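/- Let $G$ be a finite simple undirected graph on $n$ vertices with maximum degree $\Delta(G)\ge n-3$. Then $$\mathrm{rd}(G)\le \lambda^+(G)+1 .$$ Here, for distinct vertices $u,v$ of $G$, a $u$-$v$-edge-cut is a set $F$ of edges of $G$ such that $u$ and $v$ lie in different components of $G-F$; $\lambda(u,v)$ is the minimum number of edges in a $u$-$v$-edge-cut, and the upper edge-connectivity is $\lambda^+(G)=\max\{\lambda(u,v): u,v\in V(G),\ u\neq v\}$ (taken to be $0$ if $G$ has fewer than two vertices). The rainbow disconnection number $\mathrm{rd}(G)$ is the smallest number $k$ of colors for which there is a (not necessarily proper) coloring of the edges of $G$ with $k$ colors such that any two distinct vertices $u,v$ are separated by a $u$-$v$-edge-cut no two of whose edges have the same color. -/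

import Mathlib

namespace SimpleGraph

variable {V : Type*}

/-- `F` is a set of edges of `G` whose deletion leaves `u` and `v` in different components. -/
def IsEdgeCutBetween (G : SimpleGraph V) (u v : V) (F : Set (Sym2 V)) : Prop :=
  F ⊆ G.edgeSet ∧ ¬ (G.deleteEdges F).Reachable u v

/-- `λ(u, v)`: the minimum number of edges in an edge-cut separating `u` and `v`
(used for distinct `u` and `v` only). -/
noncomputable def localEdgeConnectivity (G : SimpleGraph V) (u v : V) : ℕ :=
  sInf {m : ℕ | ∃ F : Finset (Sym2 V), G.IsEdgeCutBetween u v (F : Set (Sym2 V)) ∧ F.card = m}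

/-- `λ⁺(G)`: the maximum of `λ(u, v)` over all pairs of distinct vertices; it is `0` when there
is no such pair. On a finite graph the set below is finite, so its supremum is a maximum. -/
noncomputable def upperEdgeConnectivity (G : SimpleGraph V) : ℕ :=
  sSup {m : ℕ | ∃ u v : V, u ≠ v ∧ G.localEdgeConnectivity u v = m}

/-- Under the edge-coloring `c`, no two edges in `R` have the same color. -/
def IsRainbow {G : SimpleGraph V} {K : Type*} (c : G.EdgeLabeling K) (R : Set (Sym2 V)) : Prop :=
  ∀ e f : G.edgeSet, (e : Sym2 V) ∈ R → (f : Sym2 V) ∈ R → c e = c f → e = f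

/-- `c` is a rainbow disconnection coloring of `G`: any two distinct vertices are separated by
a rainbow edge-cut. The coloring is an arbitrary map on the edges, not necessarily proper. -/
def IsRainbowDisconnectionColoring (G : SimpleGraph V) {K : Type*} (c : G.EdgeLabeling K) : Prop :=
  ∀ u v : V, u ≠ v → ∃ R : Set (Sym2 V), G.IsEdgeCutBetween u v R ∧ IsRainbow c R

/-- `rd(G)`: the smallest number of colors in a rainbow disconnection coloring of `G`. -/
noncomputable def rainbowDisconnectionNumber (G : SimpleGraph V) : ℕ :=
  sInf {k : ℕ | ∃ c : G.EdgeLabeling (Fin k), G.IsRainbowDisconnectionColoring c}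

/-- Deleting all edges separates any two distinct vertices. -/
theorem isEdgeCutBetween_edgeSet (G : SimpleGraph V) {u v : V} (h : u ≠ v) :
    G.IsEdgeCutBetween u v G.edgeSet := by
  refine ⟨subset_rfl, ?_⟩
  simpa using h

/-- A finite graph has a rainbow disconnection coloring, so that `rd(G)` is a true minimum. -/
theorem exists_isRainbowDisconnectionColoring [Finite V] (G : SimpleGraph V) :
    ∃ (k : ℕ) (c : G.EdgeLabeling (Fin k)), G.IsRainbowDisconnectionColoring c := by
  obtain ⟨k, ⟨e⟩⟩ := Finite.exists_equiv_fin G.edgeSet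
  exact ⟨k, fun x => e x, fun u v h => ⟨G.edgeSet, G.isEdgeCutBetween_edgeSet h,
    fun a b _ _ hab => e.injective hab⟩⟩

end SimpleGraph

/-!
Write `k = λ⁺(G)`, let `w` be a vertex of maximum degree and `Z` the set of at most two
non-neighbors of `w`. If a coloring is proper at a vertex `v`, then the edges at `v` form a rainbow
cut between `v` and any other vertex. So a coloring with `k + 1` colors suffices that is proper at
all vertices but `w`, or at all vertices but `u` and `w` if some rainbow cut separates `u` from `w`
(`rainbowDisconnectionNumber_le_of_isProperAt`).

The edge `uv` and the paths `u`-`x`-`v` are edge-disjoint, so their number is at most `k`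
(`ncard_le_upperEdgeConnectivity`). As all vertices outside `Z` other than `w` are adjacent to `w`,
a vertex `v ≠ w` has at most `k` neighbors outside `Z`, where `w` itself is counted if it is one.

* If all neighbors of `w` have degree at most `k + 1`, then deleting `w` and the edge inside `Z`, if
  there is one, leaves maximum degree at most `k`. Vizing's theorem gives a proper coloring with
  `k + 1` colors, the adjacency lemma behind it (`IsProperEdgeColoring.exists_sup_edge`) puts the
  edge inside `Z` back, and each edge `wv` takes a color missing at `v`
  (`rainbowDisconnectionNumber_le_of_forall_adj_ncard_le`).
* If a neighbor `u` of `w` has degree at least `k + 2`, then `Z ⊆ N(u)` and there are exactly `k`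
  short paths between `u` and `w`, so a minimum cut has exactly one edge from each. This restricts
  the graph so much that all vertices other than `u` and `w` have degree at most `k`, and that the
  cut and all vertices other than `u` and `w` can be served by one coloring
  (`rainbowDisconnectionNumber_le_of_adj_of_lt_ncard`).

Vizing's theorem is proved by fans and Kempe chains. A fan is treated as reachability under
`FanStep`, so that only its set of vertices and, for the rotation, one path in it are needed.
-/

namespace SimpleGraph

variable {V K : Type*}

/-! ### Proper edge colorings, missing colors and Kempe changes -/

/-- `χ` is a proper coloring of the edges of `H`. Colorings are taken to be total on `Sym2 V`;
the values outside the edges of `H` are irrelevant, which makes it easy to recolor single edges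
and to compare colorings of different graphs. -/
def IsProperEdgeColoring (H : SimpleGraph V) (χ : Sym2 V → K) : Prop :=
  ∀ v a b, H.Adj v a → H.Adj v b → χ s(v, a) = χ s(v, b) → a = b

/-- The color `c` does not occur on the edges of `H` at `v`. -/
def IsMissingColor (H : SimpleGraph V) (χ : Sym2 V → K) (v : V) (c : K) : Prop :=
  ∀ a, H.Adj v a → χ s(v, a) ≠ c

theorem IsProperEdgeColoring.mono {H H' : SimpleGraph V} {χ : Sym2 V → K} (h : H' ≤ H)
    (hχ : H.IsProperEdgeColoring χ) : H'.IsProperEdgeColoring χ :=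
  fun v a b ha hb => hχ v a b (h ha) (h hb)

theorem exists_isMissingColor [Finite V] [Fintype K] {H : SimpleGraph V} (χ : Sym2 V → K) {v : V}
    (hv : (H.neighborSet v).ncard < Fintype.card K) : ∃ c, H.IsMissingColor χ v c := by
  by_contra! hcon
  have huniv : (fun a => χ s(v, a)) '' H.neighborSet v = Set.univ := by
    ext c
    simpa [IsMissingColor] using hcon c
  have := Set.ncard_image_le (f := fun a => χ s(v, a)) (Set.toFinite (H.neighborSet v))
  rw [huniv, Set.ncard_univ, Nat.card_eq_fintype_card] at this
  omega

/-- In a graph of maximum degree at most two, each component is a path or a cycle, and so it does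
not contain three vertices of degree at most one. -/
theorem not_reachable_of_three_ncard_le_one [Finite V] {L : SimpleGraph V}
    (h2 : ∀ v, (L.neighborSet v).ncard ≤ 2) {a b t : V} (hab : a ≠ b) (hat : a ≠ t) (hbt : b ≠ t)
    (ha : (L.neighborSet a).ncard ≤ 1) (hb : (L.neighborSet b).ncard ≤ 1)
    (ht : (L.neighborSet t).ncard ≤ 1) (hrb : L.Reachable a b) : ¬ L.Reachable a t := by
  classical
  intro hrt
  have := Fintype.ofFinite V
  set C := L.connectedComponentMk a
  have hbC : b ∈ C := ConnectedComponent.sound hrb.symm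
  have htC : t ∈ C := ConnectedComponent.sound hrt.symm
  have haC : a ∈ C := rfl
  -- a connected graph has at least `|C| - 1` edges, but here the degrees sum to at most `2|C| - 3`
  have hcard := C.connected_toSimpleGraph.card_vert_le_card_edgeSet_add_one
  have hsum := C.toSimpleGraph.sum_degrees_eq_twice_card_edges
  have hdeg : ∀ v : C, C.toSimpleGraph.degree v ≤ (L.neighborSet v).ncard := by
    intro v
    rw [← card_neighborSet_eq_degree, ← Nat.card_eq_fintype_card, Nat.card_coe_set_eq]
    refine Set.ncard_le_ncard_of_injOn Subtype.val ?_ Subtype.val_injective.injOn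
    intro y hy
    exact (C.toSimpleGraph_adj v.2 y.2).1 hy
  have hle : ∀ v : C, C.toSimpleGraph.degree v +
      ((if v = ⟨a, haC⟩ then 1 else 0) + (if v = ⟨b, hbC⟩ then 1 else 0) +
        (if v = ⟨t, htC⟩ then 1 else 0)) ≤ 2 := by
    intro v
    have h1 := hdeg v
    have h3 := h2 v
    by_cases hva : v = ⟨a, haC⟩
    · subst hva; simp [hab, hat]; simp at h1; omega
    by_cases hvb : v = ⟨b, hbC⟩
    · subst hvb; simp [hab.symm, hbt]; simp at h1; omega
    by_cases hvt : v = ⟨t, htC⟩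
    · subst hvt; simp [hat.symm, hbt.symm]; simp at h1; omega
    simp [hva, hvb, hvt]; omega
  have hS := Finset.sum_le_sum (s := Finset.univ) fun v _ => hle v
  simp only [Finset.sum_add_distrib, Finset.sum_ite_eq', Finset.mem_univ, if_true,
    Finset.sum_const, Finset.card_univ, smul_eq_mul] at hS
  rw [Nat.card_eq_fintype_card, Nat.card_eq_fintype_card, ← edgeFinset_card] at hcard
  omega

/-- The subgraph of `H` formed by the edges of color `c` or `d`. Its components are the Kempe
chains. -/
def kempeGraph (H : SimpleGraph V) (χ : Sym2 V → K) (c d : K) : SimpleGraph V where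
  Adj a b := H.Adj a b ∧ (χ s(a, b) = c ∨ χ s(a, b) = d)
  symm := ⟨fun a b h => ⟨h.1.symm, by rw [Sym2.eq_swap]; exact h.2⟩⟩
  loopless := ⟨fun a h => H.loopless.irrefl a h.1⟩

theorem IsProperEdgeColoring.ncard_neighborSet_kempeGraph_le {H : SimpleGraph V}
    {χ : Sym2 V → K} (hχ : H.IsProperEdgeColoring χ) (c d : K) (v : V) :
    ((H.kempeGraph χ c d).neighborSet v).ncard ≤ 2 := by
  refine (Set.ncard_le_ncard_of_injOn (t := {c, d}) (fun a => χ s(v, a)) (fun a ha => ha.2)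
    (fun a ha b hb => hχ v a b ha.1 hb.1)).trans (Set.ncard_insert_le c {d} |>.trans (by simp))

theorem IsProperEdgeColoring.ncard_neighborSet_kempeGraph_le_one {H : SimpleGraph V}
    {χ : Sym2 V → K} (hχ : H.IsProperEdgeColoring χ) {c d : K} {v : V}
    (hv : H.IsMissingColor χ v c ∨ H.IsMissingColor χ v d) :
    ((H.kempeGraph χ c d).neighborSet v).ncard ≤ 1 := by
  obtain ⟨e, he⟩ : ∃ e, ∀ a ∈ (H.kempeGraph χ c d).neighborSet v, χ s(v, a) ∈ ({e} : Set K) := by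
    rcases hv with hv | hv
    · exact ⟨d, fun a ha => ha.2.resolve_left (hv a ha.1)⟩
    · exact ⟨c, fun a ha => ha.2.resolve_right (hv a ha.1)⟩
  exact (Set.ncard_le_ncard_of_injOn (fun a => χ s(v, a)) he
    (fun a ha b hb => hχ v a b ha.1 hb.1)).trans (Set.ncard_singleton e).le

open Classical in
/-- The Kempe change: interchange the colors `c` and `d` on the edges that meet `S`. It is used
when `S` is a union of components of `H.kempeGraph χ c d`. -/
noncomputable def kempeSwap (χ : Sym2 V → K) (c d : K) (S : Set V) (e : Sym2 V) : K :=
  if ∃ v ∈ e, v ∈ S then Equiv.swap c d (χ e) else χ e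

section KempeSwap

variable {H : SimpleGraph V} {χ : Sym2 V → K} {c d : K} {S : Set V}

open Classical in
theorem kempeSwap_apply (hS : ∀ a b, (H.kempeGraph χ c d).Adj a b → a ∈ S → b ∈ S) {a b : V}
    (hab : H.Adj a b) :
    kempeSwap χ c d S s(a, b) = if a ∈ S then Equiv.swap c d (χ s(a, b)) else χ s(a, b) := by
  by_cases ha : a ∈ S
  · simp [kempeSwap, ha]
  by_cases hb : b ∈ S
  · have hcol : ¬ (χ s(a, b) = c ∨ χ s(a, b) = d) := fun h =>
      ha (hS b a ⟨hab.symm, by rwa [Sym2.eq_swap]⟩ hb)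
    push Not at hcol
    simp [kempeSwap, ha, hb, Equiv.swap_apply_of_ne_of_ne hcol.1 hcol.2]
  · simp [kempeSwap, ha, hb]

open Classical in
theorem isProperEdgeColoring_kempeSwap (hχ : H.IsProperEdgeColoring χ)
    (hS : ∀ a b, (H.kempeGraph χ c d).Adj a b → a ∈ S → b ∈ S) :
    H.IsProperEdgeColoring (kempeSwap χ c d S) := by
  intro v a b ha hb h
  rw [kempeSwap_apply hS ha, kempeSwap_apply hS hb] at h
  split_ifs at h
  · exact hχ v a b ha hb ((Equiv.swap c d).injective h)
  · exact hχ v a b ha hb h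

theorem isMissingColor_kempeSwap_of_notMem
    (hS : ∀ a b, (H.kempeGraph χ c d).Adj a b → a ∈ S → b ∈ S) {v : V} (hv : v ∉ S) {e : K} :
    H.IsMissingColor (kempeSwap χ c d S) v e ↔ H.IsMissingColor χ v e := by
  refine forall₂_congr fun a ha => ?_
  rw [kempeSwap_apply hS ha, if_neg hv]

open Classical in
theorem isMissingColor_kempeSwap_of_mem
    (hS : ∀ a b, (H.kempeGraph χ c d).Adj a b → a ∈ S → b ∈ S) {v : V} (hv : v ∈ S) {e : K}
    (he : H.IsMissingColor χ v e) :
    H.IsMissingColor (kempeSwap χ c d S) v (Equiv.swap c d e) := by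
  intro a ha h
  rw [kempeSwap_apply hS ha, if_pos hv] at h
  exact he a ha ((Equiv.swap c d).injective h)

end KempeSwap

/-! ### Vizing's theorem -/

theorem IsProperEdgeColoring.update_sup_edge [DecidableEq V] {H : SimpleGraph V} {χ : Sym2 V → K}
    (hχ : H.IsProperEdgeColoring χ) {x y : V} {c : K} (hx : H.IsMissingColor χ x c)
    (hy : H.IsMissingColor χ y c) :
    (H ⊔ edge x y).IsProperEdgeColoring (Function.update χ s(x, y) c) := by
  have hmiss : ∀ v a b, s(v, a) = s(x, y) → H.Adj v b → χ s(v, b) ≠ c := by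
    intro v a b hva hb
    rcases Sym2.eq_iff.1 hva with ⟨rfl, -⟩ | ⟨rfl, -⟩
    · exact hx b hb
    · exact hy b hb
  have hadj : ∀ v a, (H ⊔ edge x y).Adj v a → s(v, a) ≠ s(x, y) → H.Adj v a := by
    intro v a h hne
    rw [sup_adj, edge_adj] at h
    rcases h with h | ⟨h, -⟩
    · exact h
    · exact absurd (Sym2.eq_iff.2 (by tauto)) hne
  intro v a b ha hb h
  by_cases h1 : s(v, a) = s(x, y) <;> by_cases h2 : s(v, b) = s(x, y)
  · exact Sym2.congr_right.1 (h1.trans h2.symm)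
  · rw [h1, Function.update_self, Function.update_of_ne h2] at h
    exact absurd h.symm (hmiss v a b h1 (hadj v b hb h2))
  · rw [h2, Function.update_self, Function.update_of_ne h1] at h
    exact absurd h (hmiss v b a h2 (hadj v a ha h1))
  · rw [Function.update_of_ne h1, Function.update_of_ne h2] at h
    exact hχ v a b (hadj v a ha h1) (hadj v b hb h2) h

/-- A step of a Vizing fan centered at `x`: if the edge `xy` is uncolored, it may take over the
color of the edge `xz`, which then becomes the uncolored one. -/
def FanStep (H : SimpleGraph V) (χ : Sym2 V → K) (x y z : V) : Prop :=
  H.Adj x z ∧ H.IsMissingColor χ y (χ s(x, z))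

theorem exists_seq_of_reflTransGen {r : V → V → Prop} {a b : V} (h : Relation.ReflTransGen r a b) :
    ∃ (n : ℕ) (p : ℕ → V), p 0 = a ∧ p n = b ∧ ∀ i < n, r (p i) (p (i + 1)) := by
  induction h with
  | refl => exact ⟨0, fun _ => a, rfl, rfl, by simp⟩
  | @tail b e _ hbe ih =>
    obtain ⟨n, p, h0, hn, hp⟩ := ih
    refine ⟨n + 1, fun i => if i ≤ n then p i else e, by simp [h0], by simp, fun i hi => ?_⟩
    rcases Nat.lt_succ_iff_lt_or_eq.1 hi with hi | rfl
    · simpa [hi.le, Nat.succ_le_of_lt hi] using hp i hi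
    · simpa [hn] using hbe

/-- Rotation of a fan. If a fan leads from the uncolored edge `xy` to a vertex at which some color
missing at `x` is missing too, then shifting the colors along the fan frees a color for `xy`.
The colors are shifted from the far end of the fan; a fan that revisits its last vertex is
shortened first. -/
theorem exists_isProperEdgeColoring_sup_edge_of_fan {H : SimpleGraph V} {x y : V} (hxy : x ≠ y)
    (n : ℕ) : ∀ (χ : Sym2 V → K) (p : ℕ → V) (c : K), H.IsProperEdgeColoring χ → p 0 = y →
      (∀ i < n, H.FanStep χ x (p i) (p (i + 1))) → H.IsMissingColor χ x c →
      H.IsMissingColor χ (p n) c → ∃ χ' : Sym2 V → K, (H ⊔ edge x y).IsProperEdgeColoring χ' := by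
  classical
  induction n using Nat.strong_induction_on with
  | _ n ih =>
  intro χ p c hχ h0 hp hx hn
  by_cases hrep : ∃ i < n, p i = p n
  · obtain ⟨i, hi, hpi⟩ := hrep
    exact ih i hi χ p c hχ h0 (fun j hj => hp j (hj.trans hi)) hx (hpi ▸ hn)
  push Not at hrep
  rcases n with - | n
  · exact ⟨_, hχ.update_sup_edge hx (h0 ▸ hn)⟩
  have hpx : ∀ i ≤ n, p i ≠ x := by
    rintro (- | i) hi
    · rw [h0]; exact hxy.symm
    · exact (hp i (by omega)).1.ne'
  set v := p (n + 1)
  have hxv : H.Adj x v := (hp n (by omega)).1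
  set χ' := Function.update χ s(x, v) c
  have hχ' : H.IsProperEdgeColoring χ' := (hχ.update_sup_edge hx hn).mono le_sup_left
  -- vertices other than `x` and `v` do not see the change of color of the edge `xv`
  have hmiss : ∀ u, u ≠ x → u ≠ v → ∀ e, H.IsMissingColor χ u e → H.IsMissingColor χ' u e := by
    intro u hux huv e he a ha
    have : s(u, a) ≠ s(x, v) := by
      intro h
      rcases Sym2.eq_iff.1 h with ⟨h, -⟩ | ⟨h, -⟩ <;> contradiction
    rw [show χ' s(u, a) = χ s(u, a) from Function.update_of_ne this _ _]
    exact he a ha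
  refine ih n (by omega) χ' p (χ s(x, v)) hχ' h0 (fun i hi => ?_) (fun a ha => ?_) ?_
  · obtain ⟨h1, h2⟩ := hp i (by omega)
    refine ⟨h1, ?_⟩
    have : s(x, p (i + 1)) ≠ s(x, v) := fun h => hrep (i + 1) (by omega) (Sym2.congr_right.1 h)
    rw [show χ' s(x, p (i + 1)) = χ s(x, p (i + 1)) from Function.update_of_ne this _ _]
    exact hmiss _ (hpx i hi.le) (hrep i (by omega)) _ h2
  · by_cases hav : a = v
    · rw [hav, show χ' s(x, v) = c from Function.update_self _ _ _]
      exact (hx v hxv).symm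
    · have : s(x, a) ≠ s(x, v) := fun h => hav (Sym2.congr_right.1 h)
      rw [show χ' s(x, a) = χ s(x, a) from Function.update_of_ne this _ _]
      exact fun h => hav (hχ x a v ha hxv h)
  · exact hmiss _ (hpx n le_rfl) (hrep n (by omega)) _ (hp n (by omega)).2

/-- Vizing's adjacency lemma: a proper coloring extends to a new edge `xy` (after changing some
colors) as soon as `x`, `y` and all neighbors of `x` miss a color. Only the neighborhood of `x`
matters; the degrees of other vertices are not bounded.

If no rotation of a fan works, then a missing color of any vertex of the fan is the color of an
edge from `x` to the fan. The fan has more vertices than colored edges, so two of its vertices miss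
a common color `d`. With `c` missing at `x`, the `c`-`d`-Kempe chain at `x` avoids one of the two,
and interchanging `c` and `d` on the chain at that vertex lets a rotation work. -/
theorem IsProperEdgeColoring.exists_sup_edge [Finite V] {H : SimpleGraph V} {χ : Sym2 V → K}
    (hχ : H.IsProperEdgeColoring χ) {x y : V} (hxy : x ≠ y) (hnadj : ¬ H.Adj x y)
    (hx : ∃ c, H.IsMissingColor χ x c) (hy : ∃ c, H.IsMissingColor χ y c)
    (hN : ∀ v, H.Adj x v → ∃ c, H.IsMissingColor χ v c) :
    ∃ χ' : Sym2 V → K, (H ⊔ edge x y).IsProperEdgeColoring χ' := by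
  classical
  by_contra hcon
  have hrot : ∀ χ : Sym2 V → K, H.IsProperEdgeColoring χ → ∀ v c,
      Relation.ReflTransGen (H.FanStep χ x) y v → H.IsMissingColor χ x c →
      ¬ H.IsMissingColor χ v c := by
    intro χ hχ v c hv hxc hvc
    obtain ⟨n, p, h0, rfl, hp⟩ := exists_seq_of_reflTransGen hv
    exact hcon (exists_isProperEdgeColoring_sup_edge_of_fan hxy n χ p c hχ h0 hp hxc hvc)
  have hfan : ∀ v, Relation.ReflTransGen (H.FanStep χ x) y v → v = y ∨ H.Adj x v := by
    intro v hv
    rcases Relation.ReflTransGen.cases_tail hv with rfl | ⟨u, -, hu⟩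
    · exact Or.inl rfl
    · exact Or.inr hu.1
  have hstep : ∀ v : {v // Relation.ReflTransGen (H.FanStep χ x) y v},
      ∃ z : {v // Relation.ReflTransGen (H.FanStep χ x) y v},
        H.Adj x z ∧ H.IsMissingColor χ v (χ s(x, z)) := by
    rintro ⟨v, hv⟩
    obtain ⟨d, hd⟩ : ∃ d, H.IsMissingColor χ v d := by
      rcases hfan v hv with rfl | h
      · exact hy
      · exact hN v h
    have : ¬ H.IsMissingColor χ x d := fun h => hrot χ hχ v d hv h hd
    simp only [IsMissingColor, not_forall, not_not] at this
    obtain ⟨z, hz, rfl⟩ := this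
    exact ⟨⟨z, hv.tail ⟨hz, hd⟩⟩, hz, hd⟩
  choose t ht ht' using hstep
  have hninj : ¬ Function.Injective t := by
    intro hinj
    obtain ⟨v, hv⟩ := Finite.surjective_of_injective hinj ⟨y, .refl⟩
    have := ht v
    rw [hv] at this
    exact hnadj this
  simp only [Function.Injective, not_forall] at hninj
  obtain ⟨⟨u, hu⟩, ⟨v, hv⟩, htuv, huv⟩ := hninj
  have hud := ht' ⟨u, hu⟩
  have hvd := ht' ⟨v, hv⟩
  rw [← htuv] at hvd
  set d := χ s(x, t ⟨u, hu⟩)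
  obtain ⟨c, hc⟩ := hx
  have key : ∀ u, Relation.ReflTransGen (H.FanStep χ x) y u → H.IsMissingColor χ u d →
      (H.kempeGraph χ c d).Reachable x u := by
    intro u hu hud
    by_contra hxu
    set S : Set V := {v | (H.kempeGraph χ c d).Reachable u v}
    have hS : ∀ a b, (H.kempeGraph χ c d).Adj a b → a ∈ S → b ∈ S :=
      fun a b hab ha => ha.trans hab.reachable
    have hxS : x ∉ S := fun h => hxu h.symm
    have hχ' := isProperEdgeColoring_kempeSwap hχ hS
    have hxc := (isMissingColor_kempeSwap_of_notMem hS hxS).2 hc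
    have hSd : ∀ v ∈ S, H.IsMissingColor χ v d →
        H.IsMissingColor (kempeSwap χ c d S) v c := by
      intro v hv hvd
      simpa using isMissingColor_kempeSwap_of_mem hS hv hvd
    -- a fan edge of color `d` would follow a vertex that now misses `c`, allowing a rotation there
    have hsurv : ∀ v, Relation.ReflTransGen (H.FanStep χ x) y v →
        Relation.ReflTransGen (H.FanStep (kempeSwap χ c d S) x) y v := by
      intro v hv
      induction hv with
      | refl => exact .refl
      | @tail v z _ hvz ih =>
        refine ih.tail ⟨hvz.1, ?_⟩
        rw [kempeSwap_apply hS hvz.1, if_neg hxS]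
        by_cases hvS : v ∈ S
        · have hne : χ s(x, z) ≠ d := fun h =>
            hrot _ hχ' v c ih hxc (hSd v hvS (h ▸ hvz.2))
          have := isMissingColor_kempeSwap_of_mem hS hvS hvz.2
          rwa [Equiv.swap_apply_of_ne_of_ne (hc z hvz.1) hne] at this
        · exact (isMissingColor_kempeSwap_of_notMem hS hvS).2 hvz.2
    exact hrot _ hχ' u c (hsurv u hu) hxc (hSd u (Reachable.refl u) hud)
  have hne : ∀ v, Relation.ReflTransGen (H.FanStep χ x) y v → x ≠ v := by
    intro v hv
    rcases hfan v hv with rfl | h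
    · exact hxy
    · exact h.ne
  exact not_reachable_of_three_ncard_le_one (hχ.ncard_neighborSet_kempeGraph_le c d)
    (hne u hu) (hne v hv) (fun h => huv (Subtype.ext h))
    (hχ.ncard_neighborSet_kempeGraph_le_one (.inl hc))
    (hχ.ncard_neighborSet_kempeGraph_le_one (.inr hud))
    (hχ.ncard_neighborSet_kempeGraph_le_one (.inr hvd)) (key u hu hud) (key v hv hvd)

/-- Vizing's theorem: a graph of maximum degree less than the number of colors has a proper edge
coloring. -/
theorem exists_isProperEdgeColoring [Finite V] [Fintype K] (H : SimpleGraph V)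
    (hH : ∀ v, (H.neighborSet v).ncard < Fintype.card K) :
    ∃ χ : Sym2 V → K, H.IsProperEdgeColoring χ := by
  classical
  have main : ∀ E : Set (Sym2 V), E ⊆ H.edgeSet →
      ∃ χ : Sym2 V → K, (fromEdgeSet E).IsProperEdgeColoring χ := by
    intro E
    induction E, Set.toFinite E using Set.Finite.induction_on with
    | empty =>
      intro _
      rcases isEmpty_or_nonempty V with hV | ⟨⟨v⟩⟩
      · exact ⟨fun e => (hV.false e.out.1).elim, fun v => (hV.false v).elim⟩
      · have : Nonempty K := Fintype.card_pos_iff.1 (by have := hH v; omega)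
        exact ⟨fun _ => Classical.arbitrary K, fun v a b ha => by simp at ha⟩
    | @insert e E he _ ih =>
      induction e with | _ x y =>
      intro hE
      obtain ⟨χ, hχ⟩ := ih ((Set.subset_insert _ _).trans hE)
      have hxy : H.Adj x y := hE (Set.mem_insert _ _)
      have hle : fromEdgeSet E ≤ H := by
        rw [← fromEdgeSet_edgeSet H]
        exact fromEdgeSet_mono ((Set.subset_insert _ _).trans hE)
      have hmiss : ∀ v, ∃ c, (fromEdgeSet E).IsMissingColor χ v c := fun v =>
        exists_isMissingColor χ
          ((Set.ncard_le_ncard (fun a ha => hle ha) (Set.toFinite _)).trans_lt (hH v))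
      have := hχ.exists_sup_edge hxy.ne (fun h => he ((fromEdgeSet_adj E).1 h).1) (hmiss x)
        (hmiss y) (fun v _ => hmiss v)
      rwa [edge, ← fromEdgeSet_union, Set.union_singleton] at this
  simpa using main H.edgeSet subset_rfl

/-! ### Edge cuts and the upper edge-connectivity -/

/-- A set of edges containing all edges that leave `S` separates the vertices of `S` from the
other vertices. -/
theorem isEdgeCutBetween_of_boundary {G : SimpleGraph V} {F : Set (Sym2 V)} (hF : F ⊆ G.edgeSet)
    (S : Set V) (hS : ∀ a b, G.Adj a b → a ∈ S → b ∉ S → s(a, b) ∈ F) {u v : V} (hu : u ∈ S)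
    (hv : v ∉ S) : G.IsEdgeCutBetween u v F := by
  refine ⟨hF, fun h => hv ?_⟩
  have : ∀ w, Relation.ReflTransGen (G.deleteEdges F).Adj u w → w ∈ S := by
    intro w hw
    induction hw with
    | refl => exact hu
    | @tail a b _ hab ih =>
      by_contra hb
      rw [deleteEdges_adj] at hab
      exact hab.2 (hS a b hab.1 ih hb)
  exact this v ((reachable_iff_reflTransGen u v).1 h)

/-- A minimum edge-cut between distinct vertices, given by one of its sides `S`; it has
`λ(u, v) ≤ λ⁺(G)` edges. -/
theorem exists_boundary_ncard_le [Finite V] (G : SimpleGraph V) {u v : V} (huv : u ≠ v) :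
    ∃ S : Set V, u ∈ S ∧ v ∉ S ∧
      {e | ∃ a b, G.Adj a b ∧ a ∈ S ∧ b ∉ S ∧ s(a, b) = e}.ncard ≤ G.upperEdgeConnectivity := by
  classical
  have hbdd : BddAbove {m : ℕ | ∃ u v : V, u ≠ v ∧ G.localEdgeConnectivity u v = m} := by
    refine ((Set.finite_range fun p : V × V => G.localEdgeConnectivity p.1 p.2).subset ?_).bddAbove
    rintro m ⟨u, v, -, rfl⟩
    exact ⟨(u, v), rfl⟩
  have hle : G.localEdgeConnectivity u v ≤ G.upperEdgeConnectivity :=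
    le_csSup hbdd ⟨u, v, huv, rfl⟩
  have hne : {m : ℕ | ∃ F : Finset (Sym2 V),
      G.IsEdgeCutBetween u v (F : Set (Sym2 V)) ∧ F.card = m}.Nonempty :=
    ⟨_, (Set.toFinite G.edgeSet).toFinset, by
      simpa using G.isEdgeCutBetween_edgeSet huv, rfl⟩
  obtain ⟨F, ⟨-, hF⟩, hcard⟩ := Nat.sInf_mem hne
  refine ⟨{a | (G.deleteEdges F).Reachable u a}, Reachable.refl u, hF, ?_⟩
  rw [← localEdgeConnectivity, ← Set.ncard_coe_finset] at hcard
  refine (Set.ncard_le_ncard ?_ F.finite_toSet).trans (hcard.trans_le hle)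
  rintro _ ⟨a, b, hab, ha, hb, rfl⟩
  by_contra h
  exact hb (Reachable.trans ha (Adj.reachable (deleteEdges_adj.2 ⟨hab, h⟩)))

open Classical in
/-- Of the path `u`-`x`-`v`, the edge which leaves a set `S` that contains `u` but not `v`. For
`x = v` this is the edge `uv` itself. -/
noncomputable def exitEdge (S : Set V) (u v x : V) : Sym2 V :=
  if x ∈ S then s(x, v) else s(u, x)

theorem exitEdge_injOn (G : SimpleGraph V) {S : Set V} {u v : V} (hu : u ∈ S) (hv : v ∉ S) :
    Set.InjOn (exitEdge S u v) {x | G.Adj u x ∧ (x = v ∨ G.Adj x v)} := by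
  rintro x ⟨hx, -⟩ y ⟨hy, -⟩ h
  have hx' := hx.ne
  have hy' := hy.ne
  simp only [exitEdge] at h
  split_ifs at h with h1 h2 h2 <;> simp only [Sym2.eq_iff] at h <;> grind

theorem exitEdge_mem_boundary {G : SimpleGraph V} {S : Set V} {u v x : V} (hu : u ∈ S)
    (hv : v ∉ S) (hux : G.Adj u x) (hxv : x = v ∨ G.Adj x v) :
    exitEdge S u v x ∈ {e | ∃ a b, G.Adj a b ∧ a ∈ S ∧ b ∉ S ∧ s(a, b) = e} := by
  simp only [exitEdge]
  split_ifs with h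
  · exact ⟨x, v, hxv.resolve_left (by rintro rfl; exact hv h), h, hv, rfl⟩
  · exact ⟨u, x, hux, hu, h, rfl⟩

/-- The edge `uv`, if present, and the paths of length two through common neighbors are
edge-disjoint, so that each cut between `u` and `v` has at least as many edges. -/
theorem ncard_le_upperEdgeConnectivity [Finite V] {G : SimpleGraph V} {u v : V} (huv : u ≠ v)
    {A : Set V} (hA : ∀ x ∈ A, G.Adj u x ∧ (x = v ∨ G.Adj x v)) :
    A.ncard ≤ G.upperEdgeConnectivity := by
  obtain ⟨S, hu, hv, hS⟩ := G.exists_boundary_ncard_le huv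
  refine (Set.ncard_le_ncard_of_injOn (exitEdge S u v)
    (fun x hx => exitEdge_mem_boundary hu hv (hA x hx).1 (hA x hx).2)
    ((G.exitEdge_injOn hu hv).mono hA) (Set.toFinite _)).trans hS

/-- If there are `λ⁺(G)` short paths between `u` and `v`, then a minimum cut between `u` and `v`
consists of exactly one edge from each of them. -/
theorem exists_boundary_eq_exitEdge [Finite V] (G : SimpleGraph V) {u v : V} (huv : u ≠ v)
    (h : G.upperEdgeConnectivity ≤ {x | G.Adj u x ∧ (x = v ∨ G.Adj x v)}.ncard) :
    ∃ S : Set V, u ∈ S ∧ v ∉ S ∧ ∀ a b, G.Adj a b → a ∈ S → b ∉ S →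
      ∃ x, G.Adj u x ∧ (x = v ∨ G.Adj x v) ∧ exitEdge S u v x = s(a, b) := by
  obtain ⟨S, hu, hv, hS⟩ := G.exists_boundary_ncard_le huv
  refine ⟨S, hu, hv, fun a b hab ha hb => ?_⟩
  have himg : exitEdge S u v '' {x | G.Adj u x ∧ (x = v ∨ G.Adj x v)} =
      {e | ∃ a b, G.Adj a b ∧ a ∈ S ∧ b ∉ S ∧ s(a, b) = e} := by
    refine Set.eq_of_subset_of_ncard_le ?_ ?_ (Set.toFinite _)
    · rintro _ ⟨x, hx, rfl⟩
      exact exitEdge_mem_boundary hu hv hx.1 hx.2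
    · rw [(G.exitEdge_injOn hu hv).ncard_image]
      exact hS.trans h
  have : s(a, b) ∈ exitEdge S u v '' {x | G.Adj u x ∧ (x = v ∨ G.Adj x v)} := by
    rw [himg]
    exact ⟨a, b, hab, ha, hb, rfl⟩
  obtain ⟨x, hx, hxe⟩ := this
  exact ⟨x, hx.1, hx.2, hxe⟩

/-! ### Rainbow disconnection colorings -/

/-- Distinct edges at `v` have distinct colors. -/
def IsProperAt (G : SimpleGraph V) (χ : Sym2 V → K) (v : V) : Prop :=
  ∀ a b, G.Adj v a → G.Adj v b → χ s(v, a) = χ s(v, b) → a = b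

theorem exists_rainbow_isEdgeCutBetween_of_isProperAt {G : SimpleGraph V} {χ : Sym2 V → K} {v : V}
    (hv : G.IsProperAt χ v) {u : V} (huv : v ≠ u) :
    ∃ R, G.IsEdgeCutBetween v u R ∧ IsRainbow (fun e : G.edgeSet => χ e) R := by
  refine ⟨G.incidenceSet v, isEdgeCutBetween_of_boundary (fun e he => he.1) {v} ?_ rfl huv.symm, ?_⟩
  · rintro a b hab rfl -
    exact ⟨hab, Sym2.mem_mk_left a b⟩
  · rintro ⟨e, he⟩ ⟨f, hf⟩ ⟨-, hve⟩ ⟨-, hvf⟩ h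
    obtain ⟨a, rfl⟩ := hve
    obtain ⟨b, rfl⟩ := hvf
    simp only [hv a b he hf h]

theorem IsEdgeCutBetween.symm {G : SimpleGraph V} {u v : V} {F : Set (Sym2 V)}
    (h : G.IsEdgeCutBetween u v F) : G.IsEdgeCutBetween v u F :=
  ⟨h.1, fun h' => h.2 h'.symm⟩

/-- Properness may fail at two vertices `u` and `w`, if some rainbow edge-cut separates them; for
`u = w` the last condition is empty. -/
theorem rainbowDisconnectionNumber_le_of_isProperAt {G : SimpleGraph V} {k : ℕ}
    {χ : Sym2 V → Fin k} {u w : V} (hχ : ∀ v, v ≠ u → v ≠ w → G.IsProperAt χ v)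
    (huw : u ≠ w → ∃ R, G.IsEdgeCutBetween u w R ∧ IsRainbow (fun e : G.edgeSet => χ e) R) :
    G.rainbowDisconnectionNumber ≤ k := by
  refine Nat.sInf_le ⟨fun e => χ e, fun p q hpq => ?_⟩
  by_cases hp : p ≠ u ∧ p ≠ w
  · exact exists_rainbow_isEdgeCutBetween_of_isProperAt (hχ p hp.1 hp.2) hpq
  by_cases hq : q ≠ u ∧ q ≠ w
  · obtain ⟨R, h1, h2⟩ := exists_rainbow_isEdgeCutBetween_of_isProperAt (hχ q hq.1 hq.2) hpq.symm
    exact ⟨R, h1.symm, h2⟩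
  have : (p = u ∧ q = w) ∨ (p = w ∧ q = u) := by grind
  rcases this with ⟨rfl, rfl⟩ | ⟨rfl, rfl⟩
  · exact huw hpq
  · obtain ⟨R, h1, h2⟩ := huw hpq.symm
    exact ⟨R, h1.symm, h2⟩

/-! ### Graphs with a vertex that has at most two non-neighbors -/

theorem rainbowDisconnectionNumber_le_of_forall_adj_ncard_le [Finite V] (G : SimpleGraph V) (w : V)
    (hZ : {z | z ≠ w ∧ ¬ G.Adj z w}.ncard ≤ 2)
    (hdeg : ∀ v, G.Adj v w → (G.neighborSet v).ncard ≤ G.upperEdgeConnectivity + 1) :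
    G.rainbowDisconnectionNumber ≤ G.upperEdgeConnectivity + 1 := by
  classical
  set k := G.upperEdgeConnectivity
  set Z : Set V := {z | z ≠ w ∧ ¬ G.Adj z w}
  let H : SimpleGraph V :=
    { Adj a b := G.Adj a b ∧ a ≠ w ∧ b ≠ w
      symm := ⟨fun a b h => ⟨h.1.symm, h.2.2, h.2.1⟩⟩
      loopless := ⟨fun a h => G.loopless.irrefl a h.1⟩ }
  let H' : SimpleGraph V :=
    { Adj a b := H.Adj a b ∧ ¬ (a ∈ Z ∧ b ∈ Z)
      symm := ⟨fun a b h => ⟨h.1.symm, fun h' => h.2 h'.symm⟩⟩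
      loopless := ⟨fun a h => H.loopless.irrefl a h.1⟩ }
  have hH : ∀ v, G.Adj v w → (H.neighborSet v).ncard < Fintype.card (Fin (k + 1)) := by
    intro v hv
    have hsub : H.neighborSet v ⊆ G.neighborSet v \ {w} := fun a ha => ⟨ha.1, ha.2.2⟩
    have h1 := Set.ncard_le_ncard hsub (Set.toFinite _)
    have h2 := Set.ncard_sdiff_singleton_lt_of_mem (show w ∈ G.neighborSet v from hv)
      (Set.toFinite _)
    have h3 := hdeg v hv
    rw [Fintype.card_fin]
    omega
  have hH' : ∀ v, (H'.neighborSet v).ncard < Fintype.card (Fin (k + 1)) := by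
    intro v
    by_cases hvw : v = w
    · have : H'.neighborSet v = ∅ := Set.eq_empty_of_forall_notMem fun a ha => ha.1.2.1 hvw
      simp [this]
    by_cases hv : G.Adj v w
    · exact (Set.ncard_le_ncard (fun a ha => ha.1) (Set.toFinite _)).trans_lt (hH v hv)
    · rw [Fintype.card_fin, Nat.lt_succ_iff]
      refine ncard_le_upperEdgeConnectivity hvw fun a ha => ⟨ha.1.1, Or.inr ?_⟩
      by_contra haw
      exact ha.2 ⟨⟨hvw, hv⟩, ha.1.2.2, haw⟩
  obtain ⟨χ, hχ⟩ : ∃ χ : Sym2 V → Fin (k + 1), H.IsProperEdgeColoring χ := by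
    obtain ⟨χ', hχ'⟩ := H'.exists_isProperEdgeColoring hH'
    by_cases hex : ∃ x ∈ Z, ∃ y ∈ Z, G.Adj x y
    · obtain ⟨x, hx, y, hy, hxy⟩ := hex
      have hZxy : Z = {x, y} := by
        refine (Set.eq_of_subset_of_ncard_le (Set.pair_subset hx hy) ?_ (Set.toFinite _)).symm
        rwa [Set.ncard_pair hxy.ne]
      have hmiss : ∀ v, ∃ c, H'.IsMissingColor χ' v c := fun v => exists_isMissingColor χ' (hH' v)
      obtain ⟨χ, hχ⟩ := hχ'.exists_sup_edge hxy.ne (fun h => h.2 ⟨hx, hy⟩) (hmiss x) (hmiss y)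
        (fun v _ => hmiss v)
      have hle : H ≤ H' ⊔ edge x y := by
        intro a b hab
        rw [sup_adj, edge_adj]
        by_cases h : a ∈ Z ∧ b ∈ Z
        · right
          have hne := hab.1.ne
          simp only [hZxy, Set.mem_insert_iff, Set.mem_singleton_iff] at h
          grind
        · exact Or.inl ⟨hab, h⟩
      exact ⟨χ, hχ.mono hle⟩
    · push Not at hex
      have hle : H ≤ H' := fun a b hab => ⟨hab, fun h => hex a h.1 b h.2 hab.1⟩
      exact ⟨χ', hχ'.mono hle⟩
  have hm : ∀ v, ∃ c, G.Adj v w → H.IsMissingColor χ v c := by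
    intro v
    by_cases hv : G.Adj v w
    · obtain ⟨c, hc⟩ := exists_isMissingColor χ (hH v hv)
      exact ⟨c, fun _ => hc⟩
    · exact ⟨0, fun h => absurd h hv⟩
  choose m hm using hm
  -- an edge at `w` takes a color missing at its other end
  let ψ : Sym2 V → Fin (k + 1) := Sym2.lift
    ⟨fun a b => if a = w then m b else if b = w then m a else χ s(a, b), fun a b => by
      dsimp only; rw [Sym2.eq_swap]; split_ifs <;> simp_all⟩
  refine rainbowDisconnectionNumber_le_of_isProperAt (χ := ψ) (u := w) (w := w)
    (fun v hv _ a b ha hb hab => ?_) (fun h => absurd rfl h)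
  by_cases haw : a = w <;> by_cases hbw : b = w
  · rw [haw, hbw]
  · subst haw
    simp only [ψ, Sym2.lift_mk, hv, hbw, if_false, if_true] at hab
    exact absurd hab.symm (hm v ha b ⟨hb, hv, hbw⟩)
  · subst hbw
    simp only [ψ, Sym2.lift_mk, hv, haw, if_false, if_true] at hab
    exact absurd hab (hm v hb a ⟨ha, hv, haw⟩)
  · simp only [ψ, Sym2.lift_mk, hv, haw, hbw, if_false] at hab
    exact hχ v a b ⟨ha, hv, haw⟩ ⟨hb, hv, hbw⟩ hab

/-- If a neighbor `u` of `w` has degree at least `λ⁺(G) + 2`, then it is adjacent to both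
non-neighbors of `w`, and the short paths between `u` and `w` already number `λ⁺(G)`, so that a
minimum cut has one edge from each of them. This forces all other vertices to have degree at most
`λ⁺(G)`. In the coloring below properness fails only at `u` and `w`, and the cut is rainbow: with
the cut edge from each path through a common neighbor `x` moved to `wx`, the cut becomes a star,
which is part of a properly colored graph. -/
theorem rainbowDisconnectionNumber_le_of_adj_of_lt_ncard [Finite V] (G : SimpleGraph V) {u w : V}
    (huw : G.Adj u w) (hZ : {z | z ≠ w ∧ ¬ G.Adj z w}.ncard ≤ 2)
    (hdeg : G.upperEdgeConnectivity + 1 < (G.neighborSet u).ncard) :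
    G.rainbowDisconnectionNumber ≤ G.upperEdgeConnectivity + 1 := by
  classical
  set Z : Set V := {z | z ≠ w ∧ ¬ G.Adj z w}
  have hP : {x | G.Adj u x ∧ (x = w ∨ G.Adj x w)}.ncard ≤ G.upperEdgeConnectivity :=
    ncard_le_upperEdgeConnectivity huw.ne fun _ h => h
  have hcover : G.neighborSet u ⊆
      {x | G.Adj u x ∧ (x = w ∨ G.Adj x w)} ∪ (G.neighborSet u ∩ Z) := by
    intro x hx
    by_cases h : x = w ∨ G.Adj x w
    · exact Or.inl ⟨hx, h⟩
    · push Not at h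
      exact Or.inr ⟨hx, h⟩
  have hcard := (Set.ncard_le_ncard hcover (Set.toFinite _)).trans (Set.ncard_union_le _ _)
  have hcap : (G.neighborSet u ∩ Z).ncard ≤ Z.ncard :=
    Set.ncard_le_ncard Set.inter_subset_right (Set.toFinite _)
  have hZu : ∀ z ∈ Z, G.Adj u z := by
    have : G.neighborSet u ∩ Z = Z :=
      Set.eq_of_subset_of_ncard_le Set.inter_subset_right (by omega) (Set.toFinite _)
    intro z hz
    rw [← this] at hz
    exact hz.1
  obtain ⟨S, huS, hwS, hS⟩ := G.exists_boundary_eq_exitEdge huw.ne (by omega)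
  have hcut : ∀ a b, G.Adj a b → a ∈ S → b ∉ S →
      (b = w ∧ G.Adj u a) ∨ (a = u ∧ (b = w ∨ G.Adj b w)) := by
    intro a b hab ha hb
    obtain ⟨x, hux, hxw, hx⟩ := hS a b hab ha hb
    simp only [exitEdge] at hx
    split_ifs at hx with hxS <;> simp only [Sym2.eq_iff] at hx <;> grind
  have hZS : ∀ z ∈ Z, z ∈ S := by
    intro z hz
    by_contra hzS
    have := hcut u z (hZu z hz) huS hzS
    obtain ⟨h1, h2⟩ : z ≠ w ∧ ¬ G.Adj z w := hz
    tauto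
  -- inside `S`, the neighbors of `v` are neighbors of `u`; outside, they are neighbors of `w`
  have hsmall : ∀ v, v ≠ u → v ≠ w → (G.neighborSet v).ncard ≤ G.upperEdgeConnectivity := by
    intro v hvu hvw
    by_cases hvS : v ∈ S
    · refine ncard_le_upperEdgeConnectivity hvu fun y hy => ⟨hy, ?_⟩
      change G.Adj v y at hy
      by_cases hyw : y = w
      · exact Or.inr (hyw ▸ huw.symm)
      by_cases hyS : y ∈ S
      · by_cases hyw' : G.Adj y w
        · have := hcut y w hyw' hyS hwS
          have := @Adj.symm V G u y
          tauto
        · exact Or.inr (hZu y ⟨hyw, hyw'⟩).symm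
      · have := hcut v y hy hvS hyS
        tauto
    · refine ncard_le_upperEdgeConnectivity hvw fun y hy => ⟨hy, ?_⟩
      change G.Adj v y at hy
      by_contra! hy'
      have := hcut y v hy.symm (hZS y hy') hvS
      have : y ≠ u := by rintro rfl; exact hy'.2 huw
      tauto
  let H : SimpleGraph V :=
    { Adj a b := G.Adj a b ∧ a ≠ u ∧ b ≠ u ∧ (a = w → G.Adj u b) ∧ (b = w → G.Adj u a)
      symm := ⟨fun a b h => ⟨h.1.symm, h.2.2.1, h.2.1, h.2.2.2.2, h.2.2.2.1⟩⟩
      loopless := ⟨fun a h => G.loopless.irrefl a h.1⟩ }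
  have hH : ∀ v, (H.neighborSet v).ncard < Fintype.card (Fin (G.upperEdgeConnectivity + 1)) := by
    intro v
    rw [Fintype.card_fin, Nat.lt_succ_iff]
    by_cases hvu : v = u
    · have : H.neighborSet v = ∅ := Set.eq_empty_of_forall_notMem fun a ha => ha.2.1 hvu
      simp [this]
    by_cases hvw : v = w
    · subst hvw
      exact ncard_le_upperEdgeConnectivity huw.ne
        fun y hy => ⟨hy.2.2.2.1 rfl, Or.inr hy.1.symm⟩
    · exact (Set.ncard_le_ncard (fun y hy => hy.1) (Set.toFinite _)).trans (hsmall v hvu hvw)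
  obtain ⟨χ, hχ⟩ := H.exists_isProperEdgeColoring hH
  choose m hm using fun v => exists_isMissingColor χ (hH v)
  -- at a common neighbor `b` of `u` and `w`, the cut edge takes the color `χ s(w, b)`; the edges at
  -- `u` or `w` outside the cut take a color missing at the other end, and the cut edge `uw` takes a
  -- color missing at `w`, so that it differs from the rest of the cut
  let gu : V → Fin (G.upperEdgeConnectivity + 1) := fun b =>
    if b = w then m w else if b ∈ S then m b else χ s(w, b)
  let gw : V → Fin (G.upperEdgeConnectivity + 1) := fun b =>
    if b ∈ S then χ s(w, b) else m b
  let ψ : Sym2 V → Fin (G.upperEdgeConnectivity + 1) := Sym2.lift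
    ⟨fun a b => if a = u then gu b else if b = u then gu a else if a = w then gw b
      else if b = w then gw a else χ s(a, b), fun a b => by
      dsimp only; rw [Sym2.eq_swap]; split_ifs <;> simp_all⟩
  have hwu := huw.ne'
  have hψu : ∀ b, ψ s(u, b) = gu b := fun b => by simp [ψ]
  have hψw : ∀ b, b ≠ u → ψ s(w, b) = gw b := fun b hb => by simp [ψ, hwu, hb]
  have hψ : ∀ a b, a ≠ u → b ≠ u → a ≠ w → b ≠ w → ψ s(a, b) = χ s(a, b) :=
    fun a b h1 h2 h3 h4 => by simp [ψ, h1, h2, h3, h4]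
  refine rainbowDisconnectionNumber_le_of_isProperAt (χ := ψ) (u := u) (w := w)
    (fun v hvu hvw => ?_) (fun _ => ?_)
  · have hedge : ∀ a, G.Adj v a → (a = (if v ∈ S then u else w) ∧ ψ s(v, a) = m v) ∨
        (a ≠ (if v ∈ S then u else w) ∧ H.Adj v (if a = u then w else a) ∧
          ψ s(v, a) = χ s(v, if a = u then w else a)) := by
      intro a ha
      by_cases hau : a = u
      · subst hau
        by_cases hvS : v ∈ S
        · left
          simp [hvS, Sym2.eq_swap (a := v), hψu, gu, hvw]
        · right
          have := hcut a v ha.symm huS hvS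
          refine ⟨by simp [hvS, huw.ne], ?_, ?_⟩
          · simp only [if_true]
            exact ⟨by tauto, hvu, hwu, fun h => absurd h hvw, fun _ => ha.symm⟩
          · simp [hvS, Sym2.eq_swap (a := v), hψu, gu, hvw]
      by_cases haw : a = w
      · subst haw
        by_cases hvS : v ∈ S
        · right
          have := hcut v a ha hvS hwS
          refine ⟨by simp [hvS, hau], ?_, ?_⟩
          · simp only [hau, if_false]
            exact ⟨ha, hvu, hau, fun h => absurd h hvw, fun _ => by tauto⟩
          · simp [hvS, Sym2.eq_swap (a := v), hψw, hvu, gw, hau]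
        · left
          simp [hvS, Sym2.eq_swap (a := v), hψw, hvu, gw]
      · right
        refine ⟨by split_ifs <;> assumption, ?_, ?_⟩
        · simp only [hau, if_false]
          exact ⟨ha, hvu, hau, fun h => absurd h hvw, fun h => absurd h haw⟩
        · simp [hau, hψ v a hvu hau hvw haw]
    intro a b ha hb hab
    rcases hedge a ha with ⟨ha1, ha2⟩ | ⟨ha1, ha2, ha3⟩ <;>
      rcases hedge b hb with ⟨hb1, hb2⟩ | ⟨hb1, hb2, hb3⟩
    · exact ha1.trans hb1.symm
    · exact absurd ((hb3.symm.trans hab.symm).trans ha2) (hm v _ hb2)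
    · exact absurd ((ha3.symm.trans hab).trans hb2) (hm v _ ha2)
    · have := hχ v _ _ ha2 hb2 ((ha3.symm.trans hab).trans hb3)
      grind
  · refine ⟨{e | ∃ a b, G.Adj a b ∧ a ∈ S ∧ b ∉ S ∧ s(a, b) = e},
      isEdgeCutBetween_of_boundary ?_ S ?_ huS hwS, ?_⟩
    · rintro _ ⟨a, b, hab, -, -, rfl⟩
      exact hab
    · exact fun a b hab ha hb => ⟨a, b, hab, ha, hb, rfl⟩
    have hedge : ∀ x, G.Adj u x → (x = w ∨ G.Adj x w) → ψ (exitEdge S u w x) =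
        if x = w then m w else χ s(w, x) := by
      intro x hux hxw
      simp only [exitEdge]
      by_cases hxw' : x = w
      · subst hxw'; simp [hwS, hψu, gu]
      by_cases hxS : x ∈ S
      · simp [hxS, Sym2.eq_swap (a := x), hψw, hux.ne', gw, hxw']
      · simp [hxS, hψu, gu, hxw']
    have hHw : ∀ x, G.Adj u x → (x = w ∨ G.Adj x w) → x ≠ w → H.Adj w x := fun x hux hxw hne =>
      ⟨(hxw.resolve_left hne).symm, hwu, hux.ne', fun _ => hux, fun h => absurd h hne⟩
    rintro ⟨e, he⟩ ⟨f, hf⟩ ⟨a, b, hab, ha, hb, rfl⟩ ⟨a', b', hab', ha', hb', rfl⟩ h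
    obtain ⟨x, hux, hxw, hx⟩ := hS a b hab ha hb
    obtain ⟨y, huy, hyw, hy⟩ := hS a' b' hab' ha' hb'
    simp only [← hx, ← hy, hedge x hux hxw, hedge y huy hyw] at h
    have hxy : x = y := by
      split_ifs at h with h1 h2 h2
      · rw [h1, h2]
      · exact absurd h.symm (hm w y (hHw y huy hyw h2))
      · exact absurd h (hm w x (hHw x hux hxw h1))
      · exact hχ w x y (hHw x hux hxw h1) (hHw y huy hyw h2) h
    simp only [← hx, ← hy, hxy]

end SimpleGraph

theorem mainTheorem3 {V : Type*} [Fintype V] (G : SimpleGraph V) [DecidableRel G.Adj]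
    (hG : Fintype.card V ≤ G.maxDegree + 3) :
    G.rainbowDisconnectionNumber ≤ G.upperEdgeConnectivity + 1 := by
  rcases isEmpty_or_nonempty V with hV | hV
  · exact Nat.sInf_le ⟨fun _ => 0, fun v => (hV.false v).elim⟩
  obtain ⟨w, hw⟩ := G.exists_maximal_degree_vertex
  have hZ : {z | z ≠ w ∧ ¬ G.Adj z w}.ncard ≤ 2 := by
    have hcompl : {z | z ≠ w ∧ ¬ G.Adj z w} = (insert w (G.neighborSet w))ᶜ := by
      ext z
      simp [G.adj_comm]
    have h1 := Set.ncard_add_ncard_compl (insert w (G.neighborSet w))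
    rw [Set.ncard_insert_of_notMem (by simp), ← Nat.card_coe_set_eq (G.neighborSet w),
      Nat.card_eq_fintype_card, SimpleGraph.card_neighborSet_eq_degree, ← hw,
      Nat.card_eq_fintype_card] at h1
    rw [hcompl]
    omega
  by_cases h : ∃ u, G.Adj u w ∧ G.upperEdgeConnectivity + 1 < (G.neighborSet u).ncard
  · obtain ⟨u, huw, hu⟩ := h
    exact G.rainbowDisconnectionNumber_le_of_adj_of_lt_ncard huw hZ hu
  · push Not at h
    exact G.rainbowDisconnectionNumber_le_of_forall_adj_ncard_le w hZ h
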